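/- \textbf{Theorem (Graded Uniqueness Theorem).} Let $R$ be a commutative ring with unit and let $E=(E^0,E^1,r,s)$ be an arbitrary directed graph (sets $E^0$ of vertices and $E^1$ of edges, with range and source maps $r,s:E^1\to E^0$). A vertex $v$ is \emph{regular} if $s^{-1}(v)$ is finite and non-empty. Rings and algebras are associative, not necessarily unital. Let $L_R(E)$ be the Leavitt path algebra, i.e. the universal $R$-algebra generated by pairwise orthogonal idempotents $\{v : v\in E^0\}$ and elements $\{e,e^*: e\in E^1\}$ subject to: $s(e)e=e=e\,r(e)$ and $r(e)e^*=e^*=e^*s(e)$ for all $e\in E^1$; $e^*e=r(e)$ and $e^*f=0$ for all $e\neq f$ in $E^1$; and $v=\sum_{e\in E^1,\,s(e)=v}ee^*$ for every regular vertex $v$. Write $x\mapsto x^*$ for the $R$-linear involution (anti-automorphism of order at most two) of $L_R(E)$ with $v\mapsto v$ and $e\mapsto e^*$, and view each finite path $\mu=e_1\cdots e_n$ of length $l(\mu)=n$ (a vertex if $n=0$) as an element of $L_R(E)$. Grade $L_R(E)$ by $\mathbb{Z}$ with $$L_R(E)_n=\operatorname{span}_R\{\alpha\beta^*:\ \alpha,\beta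 \text{ paths},\ r(\alpha)=r(\beta),\ l(\alpha)-l(\beta)=n\}.$$ Let the commutative core $M_R(E)\subseteq L_R(E)$ be the $R$-subalgebra (not required to contain a unit) generated by all elements $x=\alpha\beta^*$, with $\alpha,\beta$ paths such that $r(\alpha)=r(\beta)$, that are normal, i.e. satisfy $xx^*=x^*x$. Let $\mathcal{A}=\bigoplus_{n\in\mathbb{Z}}\mathcal{A}_n$ be a $\mathbb{Z}$-graded ring (a ring with additive subgroups $\mathcal{A}_n$ whose internal direct sum is $\mathcal{A}$, such that $\mathcal{A}_n\mathcal{A}_m\subseteq\mathcal{A}_{n+m}$), and let $\Phi:L_R(E)\to\mathcal{A}$ be a $\mathbb{Z}$-graded ring homomorphism, i.e. an additive and multiplicative map with $\Phi(L_R(E)_n)\subseteq\mathcal{A}_n$ for every $n\in\mathbb{Z}$. Then the following conditions are equivalent: \begin{itemize} \item[(i)] $\Phi$ is injective; \item[(ii)] the restriction of $\Phi$ to $M_R(E)$ is injective; \item[(iii)] $\Phi(rv)\neq 0$ for all $v\in E^0$ and all $r\in R\setminus\{0\}$. \end{itemize} -/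

import Mathlib

universe u v w

/-!
Graphs are quivers: `V` is the set of vertices, the set of edges is `Quiver.Total V`, an edge `e` has
source `e.left` and range `e.right`, and `Quiver.Path a b` is the type of paths with source `a` and
range `b`.  All rings and algebras are associative, and not necessarily unital.
-/

namespace Leavitt

/-- The symbols `v`, `e` and `e*`, for `v` a vertex and `e` an edge. -/
inductive Gen (V : Type u) [Quiver.{v} V] : Type (max u v)
  | vertex (a : V) : Gen V
  | edge (e : Quiver.Total V) : Gen V
  | ghost (e : Quiver.Total V) : Gen V

/-- The free associative non-unital `R`-algebra on the symbols `v`, `e`, `e*`. -/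
abbrev FreeAlg (R : Type w) [CommRing R] (V : Type u) [Quiver.{v} V] : Type (max u v w) :=
  MonoidAlgebra R (FreeSemigroup (Gen V))

/-- A symbol as an element of the free algebra. -/
noncomputable def symb (R : Type w) [CommRing R] {V : Type u} [Quiver.{v} V] (g : Gen V) :
    FreeAlg R V :=
  MonoidAlgebra.single (FreeSemigroup.of g) 1

open Gen in
/-- The defining relations of the Leavitt path algebra. -/
inductive Relation (R : Type w) [CommRing R] (V : Type u) [Quiver.{v} V] :
    FreeAlg R V → FreeAlg R V → Prop
  | vertex_idem (a : V) :
      Relation R V (symb R (vertex a) * symb R (vertex a)) (symb R (vertex a))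
  | vertex_orth (a b : V) (h : a ≠ b) :
      Relation R V (symb R (vertex a) * symb R (vertex b)) 0
  | source_edge (e : Quiver.Total V) :
      Relation R V (symb R (vertex e.left) * symb R (edge e)) (symb R (edge e))
  | edge_range (e : Quiver.Total V) :
      Relation R V (symb R (edge e) * symb R (vertex e.right)) (symb R (edge e))
  | range_ghost (e : Quiver.Total V) :
      Relation R V (symb R (vertex e.right) * symb R (ghost e)) (symb R (ghost e))
  | ghost_source (e : Quiver.Total V) :
      Relation R V (symb R (ghost e) * symb R (vertex e.left)) (symb R (ghost e))
  | ck1_same (e : Quiver.Total V) :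
      Relation R V (symb R (ghost e) * symb R (edge e)) (symb R (vertex e.right))
  | ck1_ne (e f : Quiver.Total V) (h : e ≠ f) :
      Relation R V (symb R (ghost e) * symb R (edge f)) 0
  /-- Here `a` is a regular vertex, as it emits exactly the edges of the finite non-empty `S`. -/
  | ck2 (a : V) (S : Finset (Quiver.Total V)) (hne : S.Nonempty)
      (hS : ∀ e : Quiver.Total V, e ∈ S ↔ e.left = a) :
      Relation R V (symb R (vertex a)) (∑ e ∈ S, symb R (edge e) * symb R (ghost e))

/-- The smallest congruence of `R`-algebras (also compatible with scalars, see `smul_con`) that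
contains the defining relations. -/
noncomputable def con (R : Type w) [CommRing R] (V : Type u) [Quiver.{v} V] : RingCon (FreeAlg R V) :=
  ringConGen fun x y => ∃ (t : R) (a b : FreeAlg R V), Relation R V a b ∧ x = t • a ∧ y = t • b

theorem smul_con (R : Type w) [CommRing R] (V : Type u) [Quiver.{v} V] (t : R)
    {x y : FreeAlg R V} (h : con R V x y) : con R V (t • x) (t • y) := by
  have h' : RingConGen.Rel (fun x y => ∃ (t : R) (a b : FreeAlg R V),
    Relation R V a b ∧ x = t • a ∧ y = t • b) x y := h
  clear h
  change RingConGen.Rel _ _ _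
  induction h' with
  | of x y h =>
    obtain ⟨s, a, b, hab, rfl, rfl⟩ := h
    exact .of _ _ ⟨t * s, a, b, hab, by rw [mul_smul], by rw [mul_smul]⟩
  | refl x => exact .refl _
  | symm _ ih => exact .symm ih
  | trans _ _ ih1 ih2 => exact .trans ih1 ih2
  | add _ _ ih1 ih2 => rw [smul_add, smul_add]; exact .add ih1 ih2
  | mul _ h2 ih1 _ => rw [← smul_mul_assoc, ← smul_mul_assoc]; exact .mul ih1 h2

end Leavitt

/-- The Leavitt path algebra `L_R(E)` of the graph `E` given by the quiver `V`: the universal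
(non-unital, associative) `R`-algebra on the symbols `v`, `e`, `e*` subject to the defining
relations. -/
def LeavittPathAlgebra (R : Type w) [CommRing R] (V : Type u) [Quiver.{v} V] : Type (max u v w) :=
  (Leavitt.con R V).Quotient

namespace LeavittPathAlgebra

open Leavitt

section Algebra

variable (R : Type w) [CommRing R] (V : Type u) [Quiver.{v} V]

noncomputable instance instNonUnitalRing : NonUnitalRing (LeavittPathAlgebra R V) :=
  inferInstanceAs (NonUnitalRing (Leavitt.con R V).Quotient)

/-- The class of an element of the free algebra. -/
noncomputable def mk (x : FreeAlg R V) : LeavittPathAlgebra R V := (x : (Leavitt.con R V).Quotient)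

theorem mk_surjective : Function.Surjective (mk R V) := Quotient.mk_surjective

theorem mk_eq_mk {x y : FreeAlg R V} : mk R V x = mk R V y ↔ Leavitt.con R V x y :=
  RingCon.eq _

theorem mk_add (x y : FreeAlg R V) : mk R V (x + y) = mk R V x + mk R V y := rfl

theorem mk_mul (x y : FreeAlg R V) : mk R V (x * y) = mk R V x * mk R V y := rfl

theorem mk_zero : mk R V 0 = 0 := rfl

noncomputable instance instSMul : SMul R (LeavittPathAlgebra R V) where
  smul t := Quotient.map' (fun x => t • x) fun _ _ h => smul_con R V t h

theorem mk_smul (t : R) (x : FreeAlg R V) : mk R V (t • x) = t • mk R V x := rfl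

noncomputable instance instModule : Module R (LeavittPathAlgebra R V) where
  one_smul x := by
    obtain ⟨x, rfl⟩ := mk_surjective R V x
    rw [← mk_smul, one_smul]
  mul_smul s t x := by
    obtain ⟨x, rfl⟩ := mk_surjective R V x
    simp only [← mk_smul, mul_smul]
  smul_zero t := by rw [← mk_zero, ← mk_smul, smul_zero]
  smul_add t x y := by
    obtain ⟨x, rfl⟩ := mk_surjective R V x
    obtain ⟨y, rfl⟩ := mk_surjective R V y
    simp only [← mk_smul, ← mk_add, smul_add]
  add_smul s t x := by
    obtain ⟨x, rfl⟩ := mk_surjective R V x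
    simp only [← mk_smul, ← mk_add, add_smul]
  zero_smul x := by
    obtain ⟨x, rfl⟩ := mk_surjective R V x
    rw [← mk_smul, zero_smul, mk_zero]

instance instIsScalarTower : IsScalarTower R (LeavittPathAlgebra R V) (LeavittPathAlgebra R V) where
  smul_assoc t x y := by
    obtain ⟨x, rfl⟩ := mk_surjective R V x
    obtain ⟨y, rfl⟩ := mk_surjective R V y
    simp only [smul_eq_mul, ← mk_smul, ← mk_mul, smul_mul_assoc]

instance instSMulCommClass :
    SMulCommClass R (LeavittPathAlgebra R V) (LeavittPathAlgebra R V) where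
  smul_comm t x y := by
    obtain ⟨x, rfl⟩ := mk_surjective R V x
    obtain ⟨y, rfl⟩ := mk_surjective R V y
    simp only [smul_eq_mul, ← mk_smul, ← mk_mul, mul_smul_comm]

/-- The quotient map as a homomorphism of non-unital algebras. -/
noncomputable def mkHom : FreeAlg R V →ₙₐ[R] LeavittPathAlgebra R V where
  toFun := mk R V
  map_smul' _ _ := rfl
  map_zero' := rfl
  map_add' _ _ := rfl
  map_mul' _ _ := rfl

theorem mk_sum {ι : Type*} (S : Finset ι) (f : ι → FreeAlg R V) :
    mk R V (∑ i ∈ S, f i) = ∑ i ∈ S, mk R V (f i) :=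
  map_sum (mkHom R V) f S

variable {V}

/-- The image of a symbol in the Leavitt path algebra. -/
noncomputable def gen (g : Gen V) : LeavittPathAlgebra R V := mk R V (symb R g)

/-- The vertex `a` as an element of the Leavitt path algebra. -/
noncomputable abbrev vertex (a : V) : LeavittPathAlgebra R V := gen R (Gen.vertex a)

/-- The edge `e` as an element of the Leavitt path algebra. -/
noncomputable abbrev edge (e : Quiver.Total V) : LeavittPathAlgebra R V := gen R (Gen.edge e)

/-- The ghost edge `e*` as an element of the Leavitt path algebra. -/
noncomputable abbrev ghost (e : Quiver.Total V) : LeavittPathAlgebra R V := gen R (Gen.ghost e)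

end Algebra

section Universal

variable {R : Type w} [CommRing R] {V : Type u} [Quiver.{v} V]

theorem mk_eq_of_relation {x y : FreeAlg R V} (h : Relation R V x y) : mk R V x = mk R V y :=
  (mk_eq_mk R V).2 (RingConGen.Rel.of _ _ ⟨1, x, y, h, (one_smul _ _).symm, (one_smul _ _).symm⟩)

theorem vertex_mul_self (a : V) : vertex R a * vertex R a = vertex R a :=
  mk_eq_of_relation (.vertex_idem a)

theorem vertex_mul_vertex {a b : V} (h : a ≠ b) : vertex R a * vertex R b = 0 :=
  mk_eq_of_relation (.vertex_orth a b h)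

theorem source_mul_edge (e : Quiver.Total V) : vertex R e.left * edge R e = edge R e :=
  mk_eq_of_relation (.source_edge e)

theorem edge_mul_range (e : Quiver.Total V) : edge R e * vertex R e.right = edge R e :=
  mk_eq_of_relation (.edge_range e)

theorem range_mul_ghost (e : Quiver.Total V) : vertex R e.right * ghost R e = ghost R e :=
  mk_eq_of_relation (.range_ghost e)

theorem ghost_mul_source (e : Quiver.Total V) : ghost R e * vertex R e.left = ghost R e :=
  mk_eq_of_relation (.ghost_source e)

theorem ghost_mul_edge_self (e : Quiver.Total V) : ghost R e * edge R e = vertex R e.right :=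
  mk_eq_of_relation (.ck1_same e)

theorem ghost_mul_edge {e f : Quiver.Total V} (h : e ≠ f) : ghost R e * edge R f = 0 :=
  mk_eq_of_relation (.ck1_ne e f h)

theorem vertex_eq_sum (a : V) (S : Finset (Quiver.Total V)) (hne : S.Nonempty)
    (hS : ∀ e : Quiver.Total V, e ∈ S ↔ e.left = a) :
    vertex R a = ∑ e ∈ S, edge R e * ghost R e :=
  (mk_eq_of_relation (.ck2 a S hne hS)).trans (mk_sum R V S _)

end Universal

/-- A family of elements of an algebra that satisfies the defining relations of the Leavitt path
algebra. -/
structure IsFamily {V : Type u} [Quiver.{v} V] {A : Type*} [NonUnitalRing A] (f : Gen V → A) :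
    Prop where
  vertex_idem (a : V) : f (.vertex a) * f (.vertex a) = f (.vertex a)
  vertex_orth (a b : V) (h : a ≠ b) : f (.vertex a) * f (.vertex b) = 0
  source_edge (e : Quiver.Total V) : f (.vertex e.left) * f (.edge e) = f (.edge e)
  edge_range (e : Quiver.Total V) : f (.edge e) * f (.vertex e.right) = f (.edge e)
  range_ghost (e : Quiver.Total V) : f (.vertex e.right) * f (.ghost e) = f (.ghost e)
  ghost_source (e : Quiver.Total V) : f (.ghost e) * f (.vertex e.left) = f (.ghost e)
  ck1_same (e : Quiver.Total V) : f (.ghost e) * f (.edge e) = f (.vertex e.right)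
  ck1_ne (e e' : Quiver.Total V) (h : e ≠ e') : f (.ghost e) * f (.edge e') = 0
  ck2 (a : V) (S : Finset (Quiver.Total V)) (hne : S.Nonempty)
    (hS : ∀ e : Quiver.Total V, e ∈ S ↔ e.left = a) :
    f (.vertex a) = ∑ e ∈ S, f (.edge e) * f (.ghost e)

section Lift

variable {R : Type w} [CommRing R] {V : Type u} [Quiver.{v} V]
  {A : Type*} [NonUnitalRing A] [Module R A] [IsScalarTower R A A] [SMulCommClass R A A]

/-- The homomorphism from the free algebra given by the values on the symbols. -/
noncomputable def freeLift (f : Gen V → A) : FreeAlg R V →ₙₐ[R] A :=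
  MonoidAlgebra.liftMagma R (FreeSemigroup.lift f)

theorem freeLift_symb (f : Gen V → A) (g : Gen V) : freeLift (R := R) f (symb R g) = f g := by
  simp [freeLift, symb]

theorem freeLift_eq {f : Gen V → A} (hf : IsFamily f) {x y : FreeAlg R V}
    (h : Leavitt.con R V x y) : freeLift (R := R) f x = freeLift (R := R) f y := by
  have h' : RingConGen.Rel (fun x y => ∃ (t : R) (a b : FreeAlg R V),
    Relation R V a b ∧ x = t • a ∧ y = t • b) x y := h
  clear h
  induction h' with
  | of x y h =>
    obtain ⟨s, a, b, hab, rfl, rfl⟩ := h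
    rw [map_smul, map_smul]
    congr 1
    cases hab <;> simp only [map_mul, map_sum, map_zero, freeLift_symb]
    · exact hf.vertex_idem _
    · exact hf.vertex_orth _ _ ‹_›
    · exact hf.source_edge _
    · exact hf.edge_range _
    · exact hf.range_ghost _
    · exact hf.ghost_source _
    · exact hf.ck1_same _
    · exact hf.ck1_ne _ _ ‹_›
    · exact hf.ck2 _ _ ‹_› ‹_›
  | refl x => rfl
  | symm _ ih => exact ih.symm
  | trans _ _ ih1 ih2 => exact ih1.trans ih2
  | add _ _ ih1 ih2 => rw [map_add, map_add, ih1, ih2]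
  | mul _ _ ih1 ih2 => rw [map_mul, map_mul, ih1, ih2]

/-- The universal property: a family that satisfies the relations extends to a homomorphism. -/
noncomputable def lift (f : Gen V → A) (hf : IsFamily f) : LeavittPathAlgebra R V →ₙₐ[R] A where
  toFun x := Quotient.liftOn' x (freeLift (R := R) f) fun _ _ h => freeLift_eq hf h
  map_smul' t x := by
    obtain ⟨x, rfl⟩ := mk_surjective R V x
    exact map_smul (freeLift (R := R) f) t x
  map_zero' := map_zero (freeLift (R := R) f)
  map_add' x y := by
    obtain ⟨x, rfl⟩ := mk_surjective R V x
    obtain ⟨y, rfl⟩ := mk_surjective R V y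
    exact map_add (freeLift (R := R) f) x y
  map_mul' x y := by
    obtain ⟨x, rfl⟩ := mk_surjective R V x
    obtain ⟨y, rfl⟩ := mk_surjective R V y
    exact map_mul (freeLift (R := R) f) x y

theorem lift_gen (f : Gen V → A) (hf : IsFamily f) (g : Gen V) :
    lift (R := R) f hf (gen R g) = f g :=
  freeLift_symb f g

end Lift

/-- The universal property: the extension is unique. -/
theorem hom_ext {R : Type w} [CommRing R] {V : Type u} [Quiver.{v} V]
    {A : Type*} [NonUnitalRing A] [Module R A] {φ ψ : LeavittPathAlgebra R V →ₙₐ[R] A} (h : ∀ g, φ (gen R g) = ψ (gen R g)) :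
    φ = ψ := by
  have key : φ.comp (mkHom R V) = ψ.comp (mkHom R V) := by
    apply MonoidAlgebra.nonUnitalAlgHom_ext
    intro x
    induction x using FreeSemigroup.recOnMul with
    | ih1 g => exact h g
    | ih2 g y h1 h2 =>
      have e : (MonoidAlgebra.single (FreeSemigroup.of g * y) 1 : FreeAlg R V) =
        MonoidAlgebra.single (FreeSemigroup.of g) 1 * MonoidAlgebra.single y 1 := by
        rw [MonoidAlgebra.single_mul_single, one_mul]
      rw [e, map_mul, map_mul, h1, h2]
  ext x
  obtain ⟨x, rfl⟩ := mk_surjective R V x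
  exact DFunLike.congr_fun key x

section Involution

variable {R : Type w} [CommRing R] {V : Type u} [Quiver.{v} V]

/-- The values of the involution on the symbols, in the opposite algebra. -/
noncomputable def starGen : Gen V → (LeavittPathAlgebra R V)ᵐᵒᵖ
  | .vertex a => .op (vertex R a)
  | .edge e => .op (ghost R e)
  | .ghost e => .op (edge R e)

theorem isFamily_starGen : IsFamily (starGen (R := R) (V := V)) where
  vertex_idem a := congrArg MulOpposite.op (vertex_mul_self a)
  vertex_orth _ _ h := congrArg MulOpposite.op (vertex_mul_vertex h.symm)
  source_edge e := congrArg MulOpposite.op (ghost_mul_source e)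
  edge_range e := congrArg MulOpposite.op (range_mul_ghost e)
  range_ghost e := congrArg MulOpposite.op (edge_mul_range e)
  ghost_source e := congrArg MulOpposite.op (source_mul_edge e)
  ck1_same e := congrArg MulOpposite.op (ghost_mul_edge_self e)
  ck1_ne _ _ h := congrArg MulOpposite.op (ghost_mul_edge h.symm)
  ck2 a S hne hS := by
    refine (congrArg MulOpposite.op (vertex_eq_sum a S hne hS)).trans ?_
    rw [Finset.op_sum]
    rfl

/-- The involution as a homomorphism to the opposite algebra. -/
noncomputable def starHom : LeavittPathAlgebra R V →ₙₐ[R] (LeavittPathAlgebra R V)ᵐᵒᵖ :=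
  lift starGen isFamily_starGen

/-- The involution: the `R`-linear anti-automorphism with `v* = v` and `(e)* = e*`, `(e*)* = e`. -/
noncomputable instance instStar : Star (LeavittPathAlgebra R V) where
  star x := (starHom x).unop

theorem star_def (x : LeavittPathAlgebra R V) : star x = (starHom x).unop := rfl

theorem star_vertex (a : V) : star (vertex R a) = vertex R a :=
  congrArg MulOpposite.unop (lift_gen starGen isFamily_starGen (Gen.vertex a))

theorem star_edge (e : Quiver.Total V) : star (edge R e) = ghost R e :=
  congrArg MulOpposite.unop (lift_gen starGen isFamily_starGen (Gen.edge e))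

theorem star_ghost (e : Quiver.Total V) : star (ghost R e) = edge R e :=
  congrArg MulOpposite.unop (lift_gen starGen isFamily_starGen (Gen.ghost e))

theorem star_smul' (t : R) (x : LeavittPathAlgebra R V) : star (t • x) = t • star x := by
  simp only [star_def, map_smul, MulOpposite.unop_smul]

theorem star_mul' (x y : LeavittPathAlgebra R V) : star (x * y) = star y * star x := by
  simp only [star_def, map_mul, MulOpposite.unop_mul]

theorem star_add' (x y : LeavittPathAlgebra R V) : star (x + y) = star x + star y := by
  simp only [star_def, map_add, MulOpposite.unop_add]

/-- The square of the involution as a homomorphism. -/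
noncomputable def starSq : LeavittPathAlgebra R V →ₙₐ[R] LeavittPathAlgebra R V where
  toFun x := star (star x)
  map_smul' t x := by simp only [star_smul', MonoidHom.id_apply]
  map_zero' := by simp only [star_def, map_zero, MulOpposite.unop_zero]
  map_add' x y := by simp only [star_add']
  map_mul' x y := by simp only [star_mul']

theorem starSq_eq : starSq = NonUnitalAlgHom.id R (LeavittPathAlgebra R V) := by
  apply hom_ext
  rintro (a | e | e)
  · change star (star (vertex R a)) = vertex R a
    rw [star_vertex, star_vertex]
  · change star (star (edge R e)) = edge R e
    rw [star_edge, star_ghost]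
  · change star (star (ghost R e)) = ghost R e
    rw [star_ghost, star_edge]

noncomputable instance instStarRing : StarRing (LeavittPathAlgebra R V) where
  star_involutive x := DFunLike.congr_fun starSq_eq x
  star_mul := star_mul'
  star_add := star_add'

end Involution

section Core

variable (R : Type w) [CommRing R] {V : Type u} [Quiver.{v} V]

/-- A path `e₁ ⋯ eₙ` as an element of the Leavitt path algebra; the path of length zero at `a` is the
vertex `a`. The element `μ*` is then `star (path R μ)`. -/
noncomputable def path {a : V} : {b : V} → Quiver.Path a b → LeavittPathAlgebra R V
  | _, .nil => vertex R a
  | _, .cons p e => path p * edge R ⟨_, _, e⟩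

variable (V)

/-- The standard generators `α β*`, for paths `α`, `β` with the same range. -/
def standardGenerators : Set (LeavittPathAlgebra R V) :=
  {x | ∃ (a b c : V) (α : Quiver.Path a c) (β : Quiver.Path b c), x = path R α * star (path R β)}

/-- The commutative core `M_R(E)`: the (non-unital) `R`-subalgebra generated by the standard
generators that are normal elements. -/
noncomputable def commutativeCore : NonUnitalSubalgebra R (LeavittPathAlgebra R V) :=
  NonUnitalAlgebra.adjoin R {x | x ∈ standardGenerators R V ∧ IsStarNormal x}

/-- The homogeneous component of degree `n`, spanned by the `α β*` with `l(α) - l(β) = n`. (Products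
`α β*` with distinct ranges vanish, so it does not matter that they are left out.) -/
noncomputable def component (n : ℤ) : Submodule R (LeavittPathAlgebra R V) :=
  Submodule.span R {x | ∃ (a b c : V) (α : Quiver.Path a c) (β : Quiver.Path b c),
    (α.length : ℤ) - (β.length : ℤ) = n ∧ x = path R α * star (path R β)}

end Core

end LeavittPathAlgebra

/-! Vertices lie in the commutative core, so injectivity there gives (iii) as soon as `r • v ≠ 0` in
the algebra itself. This is seen in a representation on functions on `V × K`
(`smul_vertex_ne_zero`).

For (iii) ⇒ (i), homogeneous elements span and the degrees are independent in the target, so it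
suffices that a homogeneous `x` with `Φ x = 0` vanishes. Induct on a bound for the length of `β` in
the terms `α β*` of `x`. Right multiplication by an edge `e` shortens the `β`, so `x e = 0` for
every edge (`mul_edge_mem_componentLE`). By local units it remains to show `x d = 0` for each vertex
`d`. If `d` is regular, `x d = ∑ x e e* = 0`. Otherwise `x d = y + u`, with `y` a combination of
paths of one fixed length and `u` a combination of terms `t e*`, where `e` leaves `d`
(`mul_vertex_mem_sup`). At a sink `u = 0`, and the coefficients of `y` are read off by multiplying
with `p*` and killed by (iii). At an infinite emitter some edge `e` from `d` does not occur in `u`;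
then `y e = 0`, which again kills the coefficients of `y`, and `u = ∑ u e e* = 0` follows
(`eq_zero_of_mem_componentLE`). -/

namespace LeavittPathAlgebra

open Leavitt

/-! ### Multiplication of paths and ghost paths -/

section Paths

variable {R : Type w} [CommRing R] {V : Type u} [Quiver.{v} V]

/-- A property of elements of the Leavitt path algebra holds everywhere if it holds for the
generators and is stable under the algebra operations. -/
theorem induction_on {p : LeavittPathAlgebra R V → Prop} (x : LeavittPathAlgebra R V)
    (hgen : ∀ g, p (gen R g)) (hzero : p 0) (hadd : ∀ x y, p x → p y → p (x + y))
    (hsmul : ∀ (t : R) x, p x → p (t • x)) (hmul : ∀ x y, p x → p y → p (x * y)) : p x := by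
  obtain ⟨x, rfl⟩ := mk_surjective R V x
  induction x using MonoidAlgebra.induction_linear with
  | zero => exact hzero
  | add x y hx hy => exact hadd _ _ hx hy
  | single m r =>
    have e : (MonoidAlgebra.single m r : FreeAlg R V) = r • MonoidAlgebra.single m 1 := by
      rw [MonoidAlgebra.smul_single, smul_eq_mul, mul_one]
    rw [e, mk_smul]
    refine hsmul _ _ ?_
    clear e
    induction m using FreeSemigroup.recOnMul with
    | ih1 g => exact hgen g
    | ih2 g y h1 h2 =>
      have e : (MonoidAlgebra.single (FreeSemigroup.of g * y) 1 : FreeAlg R V) =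
        MonoidAlgebra.single (FreeSemigroup.of g) 1 * MonoidAlgebra.single y 1 := by
        rw [MonoidAlgebra.single_mul_single, one_mul]
      rw [e, mk_mul]
      exact hmul _ _ h1 h2

theorem vertex_mul_edge_of_ne {a : V} {e : Quiver.Total V} (h : e.left ≠ a) :
    vertex R a * edge R e = 0 := by
  rw [← source_mul_edge, ← mul_assoc, vertex_mul_vertex h.symm, zero_mul]

theorem ghost_mul_vertex_of_ne {a : V} {e : Quiver.Total V} (h : e.left ≠ a) :
    ghost R e * vertex R a = 0 := by
  rw [← ghost_mul_source, mul_assoc, vertex_mul_vertex h, mul_zero]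

theorem path_nil (a : V) : path R (Quiver.Path.nil : Quiver.Path a a) = vertex R a := rfl

theorem path_cons {a b c : V} (p : Quiver.Path a b) (e : b ⟶ c) :
    path R (p.cons e) = path R p * edge R ⟨b, c, e⟩ := rfl

theorem vertex_mul_path {a b : V} (p : Quiver.Path a b) : vertex R a * path R p = path R p := by
  induction p with
  | nil => exact vertex_mul_self a
  | cons p e ih => rw [path_cons, ← mul_assoc, ih]

theorem path_mul_vertex {a b : V} (p : Quiver.Path a b) : path R p * vertex R b = path R p := by
  cases p with
  | nil => exact vertex_mul_self a
  | cons p e => rw [path_cons, mul_assoc, edge_mul_range ⟨_, b, e⟩]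

theorem star_path_mul_vertex {a b : V} (p : Quiver.Path a b) :
    star (path R p) * vertex R a = star (path R p) := by
  rw [← star_vertex, ← star_mul, vertex_mul_path]

theorem path_comp {a b c : V} (p : Quiver.Path a b) (q : Quiver.Path b c) :
    path R (p.comp q) = path R p * path R q := by
  induction q with
  | nil => rw [Quiver.Path.comp_nil, path_nil, path_mul_vertex]
  | cons q e ih => rw [Quiver.Path.comp_cons, path_cons, ih, path_cons, mul_assoc]

/-- A path of positive length starts with an edge. -/
theorem eq_nil_or_path_eq_edge_mul {a b : V} (p : Quiver.Path a b) :
    (∃ h : a = b, p = h ▸ Quiver.Path.nil) ∨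
      ∃ (e : Quiver.Total V) (q : Quiver.Path e.right b), q.length + 1 = p.length ∧
        path R p = edge R e * path R q := by
  induction p with
  | nil => exact .inl ⟨rfl, rfl⟩
  | @cons b c p f ih =>
    right
    rcases ih with ⟨rfl, rfl⟩ | ⟨e, q, hl, hq⟩
    · refine ⟨⟨a, c, f⟩, .nil, rfl, ?_⟩
      rw [path_cons, path_nil, path_nil, source_mul_edge ⟨a, c, f⟩, edge_mul_range ⟨a, c, f⟩]
    · refine ⟨e, q.cons f, ?_, ?_⟩
      · rw [Quiver.Path.length_cons, Quiver.Path.length_cons, hl]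
      · rw [path_cons, path_cons, hq, mul_assoc]

theorem star_path_mul_self {a b : V} (p : Quiver.Path a b) :
    star (path R p) * path R p = vertex R b := by
  induction p with
  | nil => rw [path_nil, star_vertex, vertex_mul_self]
  | @cons b c p f ih =>
    rw [path_cons, star_mul, star_edge, mul_assoc, ← mul_assoc (star _), ih,
      source_mul_edge ⟨b, c, f⟩, ghost_mul_edge_self ⟨b, c, f⟩]

/-- Distinct paths of the same length are orthogonal. -/
theorem star_path_mul_path_of_ne {a b : V} (p : Quiver.Path a b) :
    ∀ {a' b' : V} (q : Quiver.Path a' b'), p.length = q.length →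
      (⟨a, b, p⟩ : Σ a b : V, Quiver.Path a b) ≠ ⟨a', b', q⟩ →
      star (path R p) * path R q = 0 := by
  induction p with
  | nil =>
    intro a' b' q hl hne
    cases q with
    | nil =>
      rw [path_nil, path_nil, star_vertex]
      refine vertex_mul_vertex fun h => hne ?_
      subst h
      rfl
    | cons q g => simp at hl
  | @cons b c p f ih =>
    intro a' b' q hl hne
    cases q with
    | nil => simp at hl
    | @cons b₁ c₁ q g =>
      have hl' : p.length = q.length := by simpa using hl
      rw [path_cons, path_cons, star_mul, star_edge, mul_assoc, ← mul_assoc (star _)]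
      by_cases h : (⟨a, b, p⟩ : Σ a b : V, Quiver.Path a b) = ⟨a', b₁, q⟩
      · cases h
        rw [star_path_mul_self, source_mul_edge ⟨b, _, g⟩]
        refine ghost_mul_edge fun h => hne ?_
        cases h
        rfl
      · rw [ih q hl' h, zero_mul, mul_zero]

end Paths

/-! ### Spanning by the products `α β*`, and local units -/

section Spanning

variable {R : Type w} [CommRing R] {V : Type u} [Quiver.{v} V]

theorem mem_iSup_component {a b c : V} (α : Quiver.Path a c) (β : Quiver.Path b c) :
    path R α * star (path R β) ∈ ⨆ n, component R V n :=
  Submodule.mem_iSup_of_mem ((α.length : ℤ) - β.length)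
    (Submodule.subset_span ⟨a, b, c, α, β, rfl, rfl⟩)

/-- The first edge of `β` gives the last factor of `β*`. An edge on the right cancels that factor,
annihilates the product, or, when `β` is trivial, extends `α`; a ghost edge lengthens `β` at its
start. -/
theorem mul_gen_mem_iSup_component {a b c : V} (α : Quiver.Path a c) (β : Quiver.Path b c)
    (g : Gen V) : path R α * star (path R β) * gen R g ∈ ⨆ n, component R V n := by
  rcases g with d | e | e
  · by_cases h : b = d
    · subst h
      rw [mul_assoc, star_path_mul_vertex]
      exact mem_iSup_component α β
    · rw [← star_path_mul_vertex, mul_assoc, mul_assoc, vertex_mul_vertex h, mul_zero, mul_zero]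
      exact zero_mem _
  · rcases eq_nil_or_path_eq_edge_mul (R := R) β with ⟨rfl, rfl⟩ | ⟨f, q, -, hq⟩
    · by_cases h : e.left = b
      · subst h
        obtain ⟨b, d, e⟩ := e
        -- Here `β` is the vertex `b = s(e)`, and `α b e` is the path `α e` times the trivial ghost
        -- path at `r(e)`.
        have := mem_iSup_component (R := R) (α.cons e) (.nil : Quiver.Path d d)
        rwa [path_cons, path_nil, star_vertex, mul_assoc, edge_mul_range ⟨b, d, e⟩,
          ← source_mul_edge, ← mul_assoc, ← star_vertex] at this
      · rw [path_nil, star_vertex, mul_assoc, vertex_mul_edge_of_ne h, mul_zero]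
        exact zero_mem _
    · rw [hq, star_mul, star_edge, mul_assoc, mul_assoc]
      by_cases h : f = e
      · subst h
        rw [ghost_mul_edge_self, star_path_mul_vertex]
        exact mem_iSup_component α q
      · rw [ghost_mul_edge h, mul_zero, mul_zero]
        exact zero_mem _
  · by_cases h : e.right = b
    · obtain ⟨d, b, e⟩ := e
      subst h
      -- `α β* e* = α (e β)*`.
      have := mem_iSup_component (R := R) α (e.toPath.comp β)
      rwa [path_comp, Quiver.Hom.toPath, path_cons, path_nil, source_mul_edge ⟨d, b, e⟩,
        star_mul, star_edge, ← mul_assoc] at this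
    · rw [← star_path_mul_vertex, mul_assoc, mul_assoc]
      change _ * (_ * (_ * ghost R e)) ∈ _
      rw [← range_mul_ghost, ← mul_assoc (vertex R b), vertex_mul_vertex (Ne.symm h), zero_mul,
        mul_zero, mul_zero]
      exact zero_mem _

variable (R V)

theorem gen_mem_iSup_component (g : Gen V) : gen R g ∈ ⨆ n, component R V n := by
  have h (a : V) : vertex R a * gen R g ∈ ⨆ n, component R V n := by
    have := mul_gen_mem_iSup_component (R := R) (.nil : Quiver.Path a a) .nil g
    rwa [path_nil, star_vertex, vertex_mul_self] at this
  rcases g with a | e | e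
  · have := h a
    rwa [vertex_mul_self] at this
  · have := h e.left
    rwa [source_mul_edge] at this
  · have := h e.right
    rwa [range_mul_ghost] at this

/-- The homogeneous components span the Leavitt path algebra. -/
theorem iSup_component : ⨆ n, component R V n = ⊤ := by
  refine (Submodule.eq_top_iff').2 fun y => ?_
  -- Stability of the span under right multiplication by `y` is carried along, since it passes from
  -- two factors to their product.
  suffices h : y ∈ ⨆ n, component R V n ∧
      ∀ x ∈ ⨆ n, component R V n, x * y ∈ ⨆ n, component R V n from h.1
  induction y using induction_on with
  | hgen g =>
    refine ⟨gen_mem_iSup_component R V g, fun x hx => ?_⟩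
    induction hx using Submodule.iSup_induction' with
    | mem n x hx =>
      induction hx using Submodule.span_induction with
      | mem x hx =>
        obtain ⟨a, b, c, α, β, -, rfl⟩ := hx
        exact mul_gen_mem_iSup_component α β g
      | zero => rw [zero_mul]; exact zero_mem _
      | add x y _ _ hx hy => rw [add_mul]; exact add_mem hx hy
      | smul t x _ hx => rw [smul_mul_assoc]; exact Submodule.smul_mem _ t hx
    | zero => rw [zero_mul]; exact zero_mem _
    | add x y _ _ hx hy => rw [add_mul]; exact add_mem hx hy
  | hzero => exact ⟨zero_mem _, fun x _ => by rw [mul_zero]; exact zero_mem _⟩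
  | hadd x y hx hy =>
    exact ⟨add_mem hx.1 hy.1, fun z hz => by rw [mul_add]; exact add_mem (hx.2 z hz) (hy.2 z hz)⟩
  | hsmul t x hx =>
    exact ⟨Submodule.smul_mem _ t hx.1, fun z hz => by
      rw [mul_smul_comm]; exact Submodule.smul_mem _ t (hx.2 z hz)⟩
  | hmul x y hx hy =>
    exact ⟨hy.2 x hx.1, fun z hz => by rw [← mul_assoc]; exact hy.2 _ (hx.2 z hz)⟩

variable {R V}

/-- Finite sums of vertices are local right units. Allowing every larger `F'` lets the sets of two
summands be merged. -/
theorem exists_eq_sum_mul_vertex (x : LeavittPathAlgebra R V) :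
    ∃ F : Finset V, ∀ F', F ⊆ F' → x = ∑ a ∈ F', x * vertex R a := by
  classical
  have of_vertex {x : LeavittPathAlgebra R V} {b : V} (h : x * vertex R b = x) :
      ∃ F : Finset V, ∀ F', F ⊆ F' → x = ∑ a ∈ F', x * vertex R a := by
    refine ⟨{b}, fun F' hF => ?_⟩
    rw [Finset.sum_eq_single_of_mem b (hF (Finset.mem_singleton_self b)), h]
    intro a _ hab
    rw [← h, mul_assoc, vertex_mul_vertex hab.symm, mul_zero]
  induction x using induction_on with
  | hgen g =>
    rcases g with a | e | e
    · exact of_vertex (vertex_mul_self a)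
    · exact of_vertex (edge_mul_range e)
    · exact of_vertex (ghost_mul_source e)
  | hzero => exact ⟨∅, fun F' _ => by simp⟩
  | hadd x y hx hy =>
    obtain ⟨F, hF⟩ := hx
    obtain ⟨G, hG⟩ := hy
    refine ⟨F ∪ G, fun F' h => ?_⟩
    simp only [add_mul, Finset.sum_add_distrib]
    rw [← hF F' (Finset.union_subset_left h), ← hG F' (Finset.union_subset_right h)]
  | hsmul t x hx =>
    obtain ⟨F, hF⟩ := hx
    refine ⟨F, fun F' h => ?_⟩
    simp only [smul_mul_assoc, ← Finset.smul_sum]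
    rw [← hF F' h]
  | hmul x y _ hy =>
    obtain ⟨F, hF⟩ := hy
    refine ⟨F, fun F' h => ?_⟩
    simp only [mul_assoc]
    rw [← Finset.mul_sum, ← hF F' h]

theorem eq_zero_of_mul_vertex {x : LeavittPathAlgebra R V} (h : ∀ a, x * vertex R a = 0) :
    x = 0 := by
  obtain ⟨F, hF⟩ := exists_eq_sum_mul_vertex x
  rw [hF F subset_rfl]
  exact Finset.sum_eq_zero fun a _ => h a

end Spanning

/-! ### A representation in which nonzero multiples of vertices do not vanish -/

section Faithful

/-- There is a set that is in bijection with its product with the set of edges that leave any given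
vertex, unless the vertex is a sink. -/
theorem exists_branching (V : Type u) [Quiver.{v} V] :
    ∃ K : Type (max u v), Nonempty K ∧ ∀ a : V, (∃ e : Quiver.Total V, e.left = a) →
      Nonempty ({e : Quiver.Total V // e.left = a} × K ≃ K) := by
  by_cases hE : Nonempty (Quiver.Total V)
  swap
  · exact ⟨PUnit, inferInstance, fun a ⟨e, _⟩ => (hE ⟨e⟩).elim⟩
  -- The factor `ℕ` makes `K` infinite and the other makes it at least as large as each set of
  -- outgoing edges, so `K` absorbs the product.
  refine ⟨ℕ × Quiver.Total V, inferInstance, fun a ⟨e, he⟩ => ?_⟩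
  have : Nonempty {e : Quiver.Total V // e.left = a} := ⟨⟨e, he⟩⟩
  refine Cardinal.eq.1 ?_
  rw [Cardinal.mk_prod, Cardinal.lift_id, Cardinal.lift_id]
  refine Cardinal.mul_eq_right (Cardinal.aleph0_le_mk _) ?_ (Cardinal.mk_ne_zero _)
  exact Cardinal.mk_le_of_injective (f := fun e => ((0, e.1) : ℕ × Quiver.Total V))
    fun e f h => Subtype.ext (Prod.ext_iff.1 h).2

variable (R : Type w) [CommRing R] {V : Type u} [Quiver.{v} V] {K : Type*}
  (φ : ∀ a : V, (∃ e : Quiver.Total V, e.left = a) → {e : Quiver.Total V // e.left = a} × K ≃ K)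

open Classical in
/-- The operators on functions on `V × K` by which the symbols act. -/
noncomputable def branchingOp : Gen V → Module.End R (V → K → R)
  | .vertex a =>
    { toFun := fun f b k => if b = a then f b k else 0
      map_add' := fun f g => by
        funext b k
        by_cases h : b = a <;> simp [h]
      map_smul' := fun t f => by
        funext b k
        by_cases h : b = a <;> simp [h] }
  | .edge e =>
    -- The bijection `φ` at `s(e)` cuts the fibre over `s(e)` into blocks labelled by the outgoing
    -- edges. The operator copies the values over `r(e)` to the block of `e`.
    { toFun := fun f b k =>
        if h : e.left = b then
          if ((φ b ⟨e, h⟩).symm k).1.1 = e then f e.right ((φ b ⟨e, h⟩).symm k).2 else 0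
        else 0
      map_add' := fun f g => by
        funext b k
        simp only [Pi.add_apply]
        split_ifs <;> simp
      map_smul' := fun t f => by
        funext b k
        simp only [Pi.smul_apply, RingHom.id_apply]
        split_ifs <;> simp }
  | .ghost e =>
    -- Conversely, the values on the block of `e` are copied back to the fibre over `r(e)`.
    { toFun := fun f b k =>
        if b = e.right then f e.left (φ e.left ⟨e, rfl⟩ (⟨e, rfl⟩, k)) else 0
      map_add' := fun f g => by
        funext b k
        by_cases h : b = e.right <;> simp [h]
      map_smul' := fun t f => by
        funext b k
        by_cases h : b = e.right <;> simp [h] }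

variable {R}

open Classical in
theorem branchingOp_vertex (a b : V) (k : K) (f : V → K → R) :
    branchingOp R φ (.vertex a) f b k = if b = a then f b k else 0 := rfl

open Classical in
theorem branchingOp_edge (e : Quiver.Total V) (b : V) (k : K) (f : V → K → R) :
    branchingOp R φ (.edge e) f b k = if h : e.left = b then
          if ((φ b ⟨e, h⟩).symm k).1.1 = e then f e.right ((φ b ⟨e, h⟩).symm k).2 else 0
        else 0 := rfl

open Classical in
theorem branchingOp_ghost (e : Quiver.Total V) (b : V) (k : K) (f : V → K → R) :
    branchingOp R φ (.ghost e) f b k =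
      if b = e.right then f e.left (φ e.left ⟨e, rfl⟩ (⟨e, rfl⟩, k)) else 0 := rfl

theorem isFamily_branchingOp : IsFamily (branchingOp R φ) where
  vertex_idem a := by
    ext f b k
    simp only [Module.End.mul_apply, branchingOp_vertex]
    split_ifs <;> rfl
  vertex_orth a a' h := by
    ext f b k
    simp only [Module.End.mul_apply, branchingOp_vertex]
    split_ifs with h1 h2
    · exact (h (h1.symm.trans h2)).elim
    all_goals rfl
  source_edge e := by
    ext f b k
    simp only [Module.End.mul_apply, branchingOp_vertex, branchingOp_edge]
    split_ifs with h1 h2 h3 h4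
    · rfl
    · rfl
    · exact (h2 h1.symm).elim
    · exact (h1 h4.symm).elim
    all_goals rfl
  edge_range e := by
    ext f b k
    simp only [Module.End.mul_apply, branchingOp_vertex, branchingOp_edge, if_true]
  range_ghost e := by
    ext f b k
    simp only [Module.End.mul_apply, branchingOp_vertex, branchingOp_ghost]
    split_ifs <;> rfl
  ghost_source e := by
    ext f b k
    simp only [Module.End.mul_apply, branchingOp_vertex, branchingOp_ghost, if_true]
  ck1_same e := by
    ext f b k
    simp only [Module.End.mul_apply, branchingOp_vertex, branchingOp_edge, branchingOp_ghost,
      Equiv.symm_apply_apply, dite_true, if_true]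
    split_ifs with h
    · rw [h]
    · rfl
  ck1_ne e e' h := by
    ext f b k
    simp only [Module.End.mul_apply, branchingOp_edge, branchingOp_ghost,
      Equiv.symm_apply_apply, h, if_false, dite_eq_ite, ite_self]
    rfl
  ck2 a S hne hS := by
    classical
    obtain ⟨e₀, he₀⟩ := hne
    have ha : ∃ e : Quiver.Total V, e.left = a := ⟨e₀, (hS e₀).1 he₀⟩
    ext f b k
    rw [LinearMap.sum_apply, Finset.sum_apply, Finset.sum_apply]
    simp only [Module.End.mul_apply, branchingOp_vertex, branchingOp_edge, branchingOp_ghost,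
      if_true]
    split_ifs with h
    · subst h
      -- The point lies in the block of exactly one edge `e`, and only that summand survives.
      obtain ⟨⟨⟨e, he⟩, k'⟩, rfl⟩ := (φ b ha).surjective k
      rw [Finset.sum_eq_single_of_mem e ((hS e).2 he)]
      · subst he
        simp
      · intro e' he' hne
        simp [hne.symm]
    · symm
      refine Finset.sum_eq_zero fun e he => dif_neg fun h' => h ?_
      rw [← h', (hS e).1 he]

theorem smul_vertex_ne_zero (a : V) {r : R} (hr : r ≠ 0) : r • vertex R a ≠ 0 := by
  classical
  obtain ⟨K, ⟨k⟩, hK⟩ := exists_branching V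
  let φ := fun a h => (hK a h).some
  intro h
  have h1 : r • branchingOp R φ (.vertex a) = 0 := by
    have := congrArg (lift (R := R) _ (isFamily_branchingOp (R := R) φ)) h
    rwa [map_smul, map_zero, lift_gen] at this
  -- The value at `(a, k)` of the image of the constant function `1` is `r`.
  have h2 := congrFun (congrFun (LinearMap.congr_fun h1 fun _ _ => 1) a) k
  rw [LinearMap.smul_apply, Pi.smul_apply, Pi.smul_apply, branchingOp_vertex, if_pos rfl,
    smul_eq_mul, mul_one] at h2
  exact hr h2

end Faithful

/-! ### Induction on the length of the ghost part -/

section Filtration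

variable {R : Type w} [CommRing R] {V : Type u} [Quiver.{v} V]

variable (R) in
/-- The span of the paths of length `n` with range `b`. -/
noncomputable def pathSpan (b : V) (n : ℤ) : Submodule R (LeavittPathAlgebra R V) :=
  Submodule.span R (Set.range fun p : {p : Σ a : V, Quiver.Path a b // (p.2.length : ℤ) = n} =>
    path R p.1.2)

variable (R) in
/-- The span of the `t e*`, where `e` is an edge with source `b`. -/
noncomputable def ghostSpan (b : V) : Submodule R (LeavittPathAlgebra R V) :=
  Submodule.span R {x | ∃ (t : LeavittPathAlgebra R V) (e : Quiver.Total V), e.left = b ∧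
    x = t * ghost R e}

variable (R V) in
/-- The span of the `α β*` of degree `n` with `β` of length at most `N`. -/
noncomputable def componentLE (n : ℤ) (N : ℕ) : Submodule R (LeavittPathAlgebra R V) :=
  Submodule.span R {x | ∃ (a b c : V) (α : Quiver.Path a c) (β : Quiver.Path b c),
    (α.length : ℤ) - (β.length : ℤ) = n ∧ β.length ≤ N ∧ x = path R α * star (path R β)}

theorem componentLE_mono (n : ℤ) {N M : ℕ} (h : N ≤ M) :
    componentLE R V n N ≤ componentLE R V n M :=
  Submodule.span_mono fun _ ⟨a, b, c, α, β, h1, h2, h3⟩ => ⟨a, b, c, α, β, h1, h2.trans h, h3⟩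

theorem exists_mem_componentLE {n : ℤ} {x : LeavittPathAlgebra R V} (hx : x ∈ component R V n) :
    ∃ N, x ∈ componentLE R V n N := by
  induction hx using Submodule.span_induction with
  | mem x hx =>
    obtain ⟨a, b, c, α, β, h, rfl⟩ := hx
    exact ⟨β.length, Submodule.subset_span ⟨a, b, c, α, β, h, le_rfl, rfl⟩⟩
  | zero => exact ⟨0, zero_mem _⟩
  | add x y _ _ hx hy =>
    obtain ⟨N, hN⟩ := hx
    obtain ⟨M, hM⟩ := hy
    exact ⟨max N M, add_mem (componentLE_mono n (le_max_left N M) hN)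
      (componentLE_mono n (le_max_right N M) hM)⟩
  | smul t x _ hx =>
    obtain ⟨N, hN⟩ := hx
    exact ⟨N, Submodule.smul_mem _ t hN⟩

/-- In `α β* e` the edge either cancels the first edge of `β` or, for trivial `β`, is appended to
`α`. The degree rises by one in both cases; all other products vanish. -/
theorem mul_edge_mem_componentLE {n : ℤ} {N : ℕ} {x : LeavittPathAlgebra R V}
    (hx : x ∈ componentLE R V n (N + 1)) (e : Quiver.Total V) :
    x * edge R e ∈ componentLE R V (n + 1) N := by
  induction hx using Submodule.span_induction with
  | mem x hx =>
    obtain ⟨a, b, c, α, β, hn, hN, rfl⟩ := hx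
    rcases eq_nil_or_path_eq_edge_mul (R := R) β with ⟨rfl, rfl⟩ | ⟨f, q, hl, hq⟩
    · by_cases h : e.left = b
      · subst h
        obtain ⟨b, d, e⟩ := e
        refine Submodule.subset_span ⟨a, d, d, α.cons e, .nil, ?_, Nat.zero_le _, ?_⟩
        · simpa using hn
        · rw [path_cons, path_nil, path_nil, star_vertex, star_vertex, mul_assoc, mul_assoc,
            edge_mul_range ⟨b, d, e⟩, source_mul_edge ⟨b, d, e⟩]
      · rw [path_nil, star_vertex, mul_assoc, vertex_mul_edge_of_ne h, mul_zero]
        exact zero_mem _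
    · rw [hq, star_mul, star_edge, mul_assoc, mul_assoc]
      by_cases h : f = e
      · subst h
        rw [ghost_mul_edge_self, star_path_mul_vertex]
        refine Submodule.subset_span ⟨a, _, c, α, q, ?_, by omega, rfl⟩
        rw [← hl] at hn
        push_cast at hn
        linarith
      · rw [ghost_mul_edge h, mul_zero, mul_zero]
        exact zero_mem _
  | zero => rw [zero_mul]; exact zero_mem _
  | add x y _ _ hx hy => rw [add_mul]; exact add_mem hx hy
  | smul t x _ hx => rw [smul_mul_assoc]; exact Submodule.smul_mem _ t hx

/-- Terms with trivial `β` are paths of length `n`; in all others `β*` ends in the ghost of the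
first edge of `β`. -/
theorem mul_vertex_mem_sup {n : ℤ} {N : ℕ} {x : LeavittPathAlgebra R V}
    (hx : x ∈ componentLE R V n N) (d : V) :
    x * vertex R d ∈ pathSpan R d n ⊔ ghostSpan R d := by
  induction hx using Submodule.span_induction with
  | mem x hx =>
    obtain ⟨a, b, c, α, β, hn, hN, rfl⟩ := hx
    rcases eq_nil_or_path_eq_edge_mul (R := R) β with ⟨rfl, rfl⟩ | ⟨f, q, -, hq⟩
    · rw [path_nil, star_vertex, path_mul_vertex]
      by_cases h : b = d
      · subst h
        rw [path_mul_vertex]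
        exact Submodule.mem_sup_left (Submodule.subset_span ⟨⟨⟨a, α⟩, by simpa using hn⟩, rfl⟩)
      · rw [← path_mul_vertex, mul_assoc, vertex_mul_vertex h, mul_zero]
        exact zero_mem _
    · rw [hq, star_mul, star_edge, mul_assoc, mul_assoc]
      by_cases h : f.left = d
      · subst h
        rw [ghost_mul_source, ← mul_assoc]
        exact Submodule.mem_sup_right (Submodule.subset_span ⟨_, f, rfl, rfl⟩)
      · rw [ghost_mul_vertex_of_ne h, mul_zero, mul_zero]
        exact zero_mem _
  | zero => rw [zero_mul]; exact zero_mem _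
  | add x y _ _ hx hy => rw [add_mul]; exact add_mem hx hy
  | smul t x _ hx => rw [smul_mul_assoc]; exact Submodule.smul_mem _ t hx

theorem mul_vertex_of_mem_componentLE_zero {n : ℤ} {x : LeavittPathAlgebra R V}
    (hx : x ∈ componentLE R V n 0) (d : V) : x * vertex R d ∈ pathSpan R d n := by
  induction hx using Submodule.span_induction with
  | mem x hx =>
    obtain ⟨a, b, c, α, β, hn, hN, rfl⟩ := hx
    rcases eq_nil_or_path_eq_edge_mul (R := R) β with ⟨rfl, rfl⟩ | ⟨f, q, hl, -⟩
    · rw [path_nil, star_vertex, path_mul_vertex]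
      by_cases h : b = d
      · subst h
        rw [path_mul_vertex]
        exact Submodule.subset_span ⟨⟨⟨a, α⟩, by simpa using hn⟩, rfl⟩
      · rw [← path_mul_vertex, mul_assoc, vertex_mul_vertex h, mul_zero]
        exact zero_mem _
    · omega
  | zero => rw [zero_mul]; exact zero_mem _
  | add x y _ _ hx hy => rw [add_mul]; exact add_mem hx hy
  | smul t x _ hx => rw [smul_mul_assoc]; exact Submodule.smul_mem _ t hx

theorem mul_vertex_of_mem_ghostSpan {b : V} {u : LeavittPathAlgebra R V}
    (hu : u ∈ ghostSpan R b) : u * vertex R b = u := by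
  induction hu using Submodule.span_induction with
  | mem x hx =>
    obtain ⟨t, e, rfl, rfl⟩ := hx
    rw [mul_assoc, ghost_mul_source]
  | zero => rw [zero_mul]
  | add x y _ _ hx hy => rw [add_mul, hx, hy]
  | smul t x _ hx => rw [smul_mul_assoc, hx]

/-- `t e* = (t e* e) e*`, while `e* f = 0` for `f ≠ e`. So finite sums of `e e*` act as right units
on the span even where the vertex is not regular. -/
theorem exists_eq_sum_mul_ghost {b : V} {u : LeavittPathAlgebra R V} (hu : u ∈ ghostSpan R b) :
    ∃ F : Finset (Quiver.Total V), ∀ F', F ⊆ F' →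
      u = ∑ e ∈ F', u * edge R e * ghost R e := by
  classical
  induction hu using Submodule.span_induction with
  | mem x hx =>
    obtain ⟨t, e, -, rfl⟩ := hx
    refine ⟨{e}, fun F' hF => ?_⟩
    rw [Finset.sum_eq_single_of_mem e (hF (Finset.mem_singleton_self e))]
    · rw [mul_assoc t, ghost_mul_edge_self, mul_assoc, range_mul_ghost]
    · intro f _ hf
      rw [mul_assoc t, ghost_mul_edge hf.symm, mul_zero, zero_mul]
  | zero => exact ⟨∅, fun F' _ => by simp⟩
  | add x y _ _ hx hy =>
    obtain ⟨F, hF⟩ := hx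
    obtain ⟨G, hG⟩ := hy
    refine ⟨F ∪ G, fun F' h => ?_⟩
    simp only [add_mul, Finset.sum_add_distrib]
    rw [← hF F' (Finset.union_subset_left h), ← hG F' (Finset.union_subset_right h)]
  | smul t x _ hx =>
    obtain ⟨F, hF⟩ := hx
    refine ⟨F, fun F' h => ?_⟩
    simp only [smul_mul_assoc, ← Finset.smul_sum]
    rw [← hF F' h]

/-- A combination of paths of the same length vanishes if all its coefficients do. -/
theorem eq_zero_of_mem_pathSpan {b : V} {n : ℤ} {y : LeavittPathAlgebra R V}
    (hy : y ∈ pathSpan R b n)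
    (h : ∀ (a : V) (p : Quiver.Path a b) (c : R), star (path R p) * y = c • vertex R b → c = 0) :
    y = 0 := by
  obtain ⟨c, rfl⟩ := (Finsupp.mem_span_range_iff_exists_finsupp).1 hy
  refine Finset.sum_eq_zero fun i hi => ?_
  refine (congrArg (· • path R i.1.2) (h i.1.1 i.1.2 (c i) ?_)).trans (zero_smul R _)
  -- All paths have the same length, so multiplying by the star of the `i`-th one annihilates the
  -- others and isolates its coefficient.
  rw [Finsupp.sum, Finset.mul_sum, Finset.sum_eq_single_of_mem i hi]
  · rw [mul_smul_comm, star_path_mul_self]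
  · intro j _ hj
    rw [mul_smul_comm, star_path_mul_path_of_ne, smul_zero]
    · exact_mod_cast i.2.trans j.2.symm
    · rintro h
      refine hj (Subtype.ext ?_)
      obtain ⟨⟨a, p⟩, hp⟩ := i
      obtain ⟨⟨a', q⟩, hq⟩ := j
      cases h
      rfl

variable {A : Type*} [NonUnitalRing A]

/-- A homomorphism that does not vanish on multiples of vertices is injective on the homogeneous
components. -/
theorem eq_zero_of_mem_componentLE (Φ : LeavittPathAlgebra R V →ₙ+* A)
    (hΦ : ∀ (a : V) (r : R), r ≠ 0 → Φ (r • vertex R a) ≠ 0) (N : ℕ) :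
    ∀ (n : ℤ) (x : LeavittPathAlgebra R V), x ∈ componentLE R V n N → Φ x = 0 → x = 0 := by
  classical
  have hcoeff {a : V} {r : R} (h : Φ (r • vertex R a) = 0) : r = 0 := by
    by_contra hr
    exact hΦ a r hr h
  -- As `Φ` is not assumed `R`-linear, the coefficient is isolated as `c • b = p* y` before `Φ` is
  -- applied.
  have hpath {b : V} {n : ℤ} {y : LeavittPathAlgebra R V} (hy : y ∈ pathSpan R b n)
      (h : Φ y = 0) : y = 0 :=
    eq_zero_of_mem_pathSpan hy fun a p c hc => hcoeff (by rw [← hc, map_mul, h, mul_zero])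
  induction N with
  | zero =>
    intro n x hx h0
    exact eq_zero_of_mul_vertex fun d =>
      hpath (mul_vertex_of_mem_componentLE_zero hx d) (by rw [map_mul, h0, zero_mul])
  | succ N ih =>
    intro n x hx h0
    have hedge (e : Quiver.Total V) : x * edge R e = 0 :=
      ih _ _ (mul_edge_mem_componentLE hx e) (by rw [map_mul, h0, zero_mul])
    refine eq_zero_of_mul_vertex fun d => ?_
    by_cases hreg : ∃ S : Finset (Quiver.Total V), S.Nonempty ∧
        ∀ e : Quiver.Total V, e ∈ S ↔ e.left = d
    · obtain ⟨S, hne, hS⟩ := hreg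
      rw [vertex_eq_sum d S hne hS, Finset.mul_sum]
      exact Finset.sum_eq_zero fun e _ => by rw [← mul_assoc, hedge, zero_mul]
    obtain ⟨y, hy, u, hu, hyu⟩ := Submodule.mem_sup.1 (mul_vertex_mem_sup hx d)
    obtain ⟨F, hF⟩ := exists_eq_sum_mul_ghost hu
    -- Edges that do not leave `d` contribute nothing to `u = ∑ u e e*`, because `u = u d`.
    have hu0 (h : ∀ e : Quiver.Total V, e.left = d → u * edge R e = 0) : u = 0 := by
      rw [hF F subset_rfl]
      refine Finset.sum_eq_zero fun e _ => ?_
      by_cases he : e.left = d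
      · rw [h e he, zero_mul]
      · rw [← mul_vertex_of_mem_ghostSpan hu, mul_assoc u, vertex_mul_edge_of_ne he, mul_zero,
          zero_mul]
    have hsum (e : Quiver.Total V) (he : e.left = d) : y * edge R e + u * edge R e = 0 := by
      rw [← add_mul, hyu, mul_assoc, ← he, source_mul_edge, hedge]
    by_cases hsink : ∃ e : Quiver.Total V, e.left = d
    · -- an infinite emitter: some edge is not among those that occur in `u`
      obtain ⟨e, he, heF⟩ : ∃ e : Quiver.Total V, e.left = d ∧ e ∉ F := by
        -- Otherwise `F` contains all edges from `d`, which is then regular.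
        by_contra! hcon
        obtain ⟨e, he⟩ := hsink
        refine hreg ⟨F.filter fun e => e.left = d, ⟨e, ?_⟩, fun f => ?_⟩
        · exact Finset.mem_filter.2 ⟨hcon e he, he⟩
        · exact ⟨fun h => (Finset.mem_filter.1 h).2,
            fun h => Finset.mem_filter.2 ⟨hcon f h, h⟩⟩
      have hue : u * edge R e = 0 := by
        rw [hF F subset_rfl, Finset.sum_mul]
        refine Finset.sum_eq_zero fun f hf => ?_
        rw [mul_assoc, ghost_mul_edge (ne_of_mem_of_not_mem hf heF), mul_zero]
      have hye : y * edge R e = 0 := by simpa [hue] using hsum e he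
      have hy0 : y = 0 := by
        -- `Φ y = 0` is not known here, but `y e = 0` is, and `e* p* y e = c • r(e)` moves the
        -- coefficient to the vertex `r(e)`.
        refine eq_zero_of_mem_pathSpan hy fun a p c hc => hcoeff (a := e.right) ?_
        have : c • vertex R e.right = ghost R e * (star (path R p) * y * edge R e) := by
          rw [hc, ← he, smul_mul_assoc, source_mul_edge, mul_smul_comm, ghost_mul_edge_self]
        rw [this, mul_assoc (star _), hye, mul_zero, mul_zero, map_zero]
      rw [← hyu, hy0, zero_add]
      exact hu0 fun f hf => by simpa [hy0] using hsum f hf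
    -- At a sink there is no ghost part, so `x d = y` and `Φ y = 0`.
    · have hu' : u = 0 := hu0 fun e he => (hsink ⟨e, he⟩).elim
      rw [← hyu, hu', add_zero]
      refine hpath hy ?_
      rw [hu', add_zero] at hyu
      rw [hyu, map_mul, h0, zero_mul]

/-- Any decomposition of `x` into homogeneous terms will do: their images lie in independent
subgroups, so if they sum to zero, each is zero. -/
theorem injective_of_injective_on_component {𝒜 : ℤ → AddSubgroup A}
    (h𝒜 : DirectSum.IsInternal 𝒜) (Φ : LeavittPathAlgebra R V →ₙ+* A)
    (hΦ : ∀ (n : ℤ) (x : LeavittPathAlgebra R V), x ∈ component R V n → Φ x ∈ 𝒜 n)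
    (h : ∀ (n : ℤ) (x : LeavittPathAlgebra R V), x ∈ component R V n → Φ x = 0 → x = 0) :
    Function.Injective Φ := by
  classical
  refine (injective_iff_map_eq_zero Φ).2 fun x hx => ?_
  obtain ⟨f, hf, rfl⟩ := (Submodule.mem_iSup_iff_exists_finsupp _ x).1
    ((iSup_component R V).symm ▸ Submodule.mem_top : x ∈ ⨆ n, component R V n)
  refine Finset.sum_eq_zero fun n hn => h n _ (hf n) ?_
  -- The images of the terms, assembled in the external direct sum, where the vanishing of the total
  -- can be read off degree by degree.
  let z : DirectSum ℤ fun n => 𝒜 n :=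
    ∑ n ∈ f.support, DirectSum.of (fun n => 𝒜 n) n ⟨Φ (f n), hΦ n _ (hf n)⟩
  have hz : z = 0 := by
    refine h𝒜.1 ?_
    rw [map_zero, map_sum]
    simp only [DirectSum.coeAddMonoidHom_of]
    rw [← map_sum]
    exact hx
  have hzn : (z n : A) = Φ (f n) := by
    have : z n = ∑ m ∈ f.support,
        DirectSum.of (fun n => 𝒜 n) m ⟨Φ (f m), hΦ m _ (hf m)⟩ n := DFinsupp.finsetSum_apply _ _ _
    rw [this, Finset.sum_eq_single_of_mem n hn, DirectSum.of_eq_same]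
    intro m _ hm
    exact DirectSum.of_eq_of_ne _ _ _ hm.symm
  rw [← hzn, hz]
  rfl

end Filtration

/-! ### Vertices in the commutative core, and the equivalence -/

theorem vertex_mem_commutativeCore {R : Type w} [CommRing R] {V : Type u} [Quiver.{v} V] (a : V) :
    vertex R a ∈ commutativeCore R V := by
  refine NonUnitalAlgebra.subset_adjoin R ⟨⟨a, a, a, .nil, .nil, ?_⟩, ⟨?_⟩⟩
  · rw [path_nil, star_vertex, vertex_mul_self]
  · rw [star_vertex]

end LeavittPathAlgebra

theorem mainTheorem8 {R : Type w} [CommRing R] {V : Type u} [Quiver.{v} V]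
    {A : Type*} [NonUnitalRing A] (𝒜 : ℤ → AddSubgroup A) [SetLike.GradedMul 𝒜]
    (h𝒜 : DirectSum.IsInternal 𝒜)
    (Φ : LeavittPathAlgebra R V →ₙ+* A)
    (hΦ : ∀ (n : ℤ) (x : LeavittPathAlgebra R V),
      x ∈ LeavittPathAlgebra.component R V n → Φ x ∈ 𝒜 n) :
    List.TFAE [
      Function.Injective Φ,
      Set.InjOn Φ (LeavittPathAlgebra.commutativeCore R V),
      ∀ (a : V) (r : R), r ≠ 0 → Φ (r • LeavittPathAlgebra.vertex R a) ≠ 0] := by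
  tfae_have 1 → 2 := fun h => h.injOn
  tfae_have 2 → 3 := fun h a r hr h0 =>
    LeavittPathAlgebra.smul_vertex_ne_zero a hr <|
      h (SMulMemClass.smul_mem r (LeavittPathAlgebra.vertex_mem_commutativeCore a))
        (zero_mem _) (h0.trans (map_zero Φ).symm)
  tfae_have 3 → 1 := fun h =>
    LeavittPathAlgebra.injective_of_injective_on_component h𝒜 Φ hΦ fun n x hx h0 =>
      have ⟨N, hN⟩ := LeavittPathAlgebra.exists_mem_componentLE hx
      LeavittPathAlgebra.eq_zero_of_mem_componentLE Φ h N n x hN h0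
  tfae_finish
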